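/- Let $(X,d)$ be a proper Hadamard space (a proper, complete geodesic metric space that is CAT(0)), with geometric boundary $\partial X$ (asymptote classes of geodesic rays), and let $\overline X=X\cup\partial X$ carry the cone topology. For $z\in X$ and $\eta\in\partial X$ let $\sigma_{z,\eta}$ be the geodesic ray from $z$ in the class $\eta$, and let $B_r(x)$ denote the open ball. A geodesic line is an isometric map $v:\mathbb R\to X$, with end points $v^\pm=v(\pm\infty)\in\partial X$; for $\xi,\eta\in\partial X$ let $(\xi\eta)\subset X$ be the set of all points $v(0)$, where $v$ is a geodesic line with $v^-=\xi$, $v^+=\eta$. For lines $u,v$ write $u\sim v$ if $u^-=v^-$, $u^+=v^+$ and $\mathcal B_{u^-}(u(0),x)=\mathcal B_{v^-}(v(0),x)$ for all $x\in X$, where $\mathcal B_\xi(p,q)=\lim_{s\to\infty}\bigl(d(p,\sigma(s))-d(q,\sigma(s))\bigr)$ for a ray $\sigma$ in the class $\xi$. The line $v$ has zero width if $\sup\{d(u(0),w(0)) : u\sim v,\ w\sim v\}=0$. It is $\mathrm{Is}(X)$-recurrent if there are isometries $g_n$ of $X$ and $t_n\to\infty$ such that the lines $t\mapsto g_n v(t+t_n)$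 converge to $v$ in the metric $d_1(u,w)=\sup_{t\in\mathbb R}e^{-|t|}d(u(t),w(t))$. Let $\partial X^{\mathrm{rec}}\subset\partial X$ be the set of the end points $v^+$ of all $\mathrm{Is}(X)$-recurrent lines $v$ of zero width. For $r>0$, $x\in X$ and $\xi\in\partial X$ put $$\mathcal O_r(\xi,x)=\{\eta\in\partial X : \text{there is a geodesic line } v \text{ with } v^-=\xi,\ v^+=\eta,\ v(0)\in B_r(x)\},$$ $$\widetilde\partial\mathcal O_r(\xi,x)=\{\eta\in\partial X : (\xi\eta)\neq\emptyset \text{ and } d(x,(\xi\eta))=r\}.$$ For $z\in X$ put $$\mathcal O^-_r(z,x)=\{\eta\in\partial X : \forall\, z'\in B_r(z),\ \sigma_{z',\eta}([0,\infty))\cap B_r(x)\neq\emptyset\},$$ $$\mathcal O^+_r(z,x)=\{\eta\in\partial X : \exists\, z'\in B_r(z),\ \sigma_{z',\eta}([0,\infty))\cap B_r(x)\neq\emptyset\},$$ and for $z\in\partial X$ put $\mathcal O^\pm_r(z,x)=\mathcal O_r(z,x)$. **Proposition.** Let $\xi\in\partial X$, $x\in X$ and $r>0$. For every sequence $(z_n)$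 in $\overline X$ converging to $\xi$, and for each of the signs $+$ and $-$: (a) $\displaystyle\limsup_{n\to\infty}\bigl(\mathcal O^\pm_r(z_n,x)\cap\partial X^{\mathrm{rec}}\bigr)\subset\bigl(\mathcal O_r(\xi,x)\cup\widetilde\partial\mathcal O_r(\xi,x)\bigr)\cap\partial X^{\mathrm{rec}}$; (b) $\displaystyle\liminf_{n\to\infty}\bigl(\mathcal O^\pm_r(z_n,x)\cap\partial X^{\mathrm{rec}}\bigr)\supset\mathcal O_r(\xi,x)\cap\partial X^{\mathrm{rec}}$. Here $\limsup_n A_n=\bigcap_n\bigcup_{k\ge n}A_k$ and $\liminf_n A_n=\bigcup_n\bigcap_{k\ge n}A_k$. -/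

import Mathlib

open Set Filter Topology
open scoped NNReal ENNReal

namespace CAT0

/-- `σ`, restricted to `[0, d(x,y)]`, is a geodesic from `x` to `y`. -/
def IsGeodesicSegment {X : Type*} [MetricSpace X] (σ : ℝ → X) (x y : X) : Prop :=
  σ 0 = x ∧ σ (dist x y) = y ∧
    ∀ s ∈ Icc (0 : ℝ) (dist x y), ∀ t ∈ Icc (0 : ℝ) (dist x y), dist (σ s) (σ t) = |s - t|

/-- A Hadamard space: a complete geodesic metric space all of whose geodesic triangles satisfy the
CAT(0) inequality. In the inequality `p, q, r` are the vertices of the triangle, `σ` and `τ` are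
two of its sides (any two sides share a vertex, here called `p`), `p', q', r'` is a comparison
triangle in the Euclidean plane, and `a', b'` are the comparison points of `σ s` and `τ t`. -/
class HadamardSpace (X : Type*) [MetricSpace X] : Prop where
  complete : CompleteSpace X
  exists_geodesic : ∀ x y : X, ∃ σ : ℝ → X, IsGeodesicSegment σ x y
  cat_zero : ∀ (p q r : X) (σ τ : ℝ → X),
    IsGeodesicSegment σ p q → IsGeodesicSegment τ p r →
    ∀ p' q' r' : EuclideanSpace ℝ (Fin 2),
      dist p' q' = dist p q → dist p' r' = dist p r → dist q' r' = dist q r →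
    ∀ s ∈ Icc (0 : ℝ) (dist p q), ∀ t ∈ Icc (0 : ℝ) (dist p r),
    ∀ a' ∈ segment ℝ p' q', ∀ b' ∈ segment ℝ p' r', dist p' a' = s → dist p' b' = t →
      dist (σ s) (τ t) ≤ dist a' b'

/-- A geodesic ray: an isometric map `[0,∞) → X`. -/
structure GeodesicRay (X : Type*) [MetricSpace X] where
  toFun : ℝ≥0 → X
  isometry : Isometry toFun

instance (X : Type*) [MetricSpace X] : CoeFun (GeodesicRay X) (fun _ => ℝ≥0 → X) :=
  ⟨GeodesicRay.toFun⟩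

/-- Two rays are asymptotic if they stay at bounded distance from each other. -/
instance asymptotic (X : Type*) [MetricSpace X] : Setoid (GeodesicRay X) where
  r σ τ := ∃ C : ℝ, ∀ t : ℝ≥0, dist (σ t) (τ t) ≤ C
  iseqv :=
    { refl := fun σ => ⟨0, fun t => by simp⟩
      symm := fun ⟨C, h⟩ => ⟨C, fun t => by rw [dist_comm]; exact h t⟩
      trans := fun ⟨C, h⟩ ⟨D, k⟩ =>
        ⟨C + D, fun t => (dist_triangle _ _ _).trans (add_le_add (h t) (k t))⟩ }

/-- The geometric boundary `∂X`: asymptote classes of geodesic rays. -/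
def Boundary (X : Type*) [MetricSpace X] : Type _ := Quotient (asymptotic X)

/-- The boundary point represented by a ray. -/
def GeodesicRay.endpoint {X : Type*} [MetricSpace X] (σ : GeodesicRay X) : Boundary X :=
  Quotient.mk (asymptotic X) σ

/-- The set `X ∪ ∂X`. -/
inductive Compactification (X : Type*) [MetricSpace X] where
  | pt : X → Compactification X
  | bd : Boundary X → Compactification X

/-- `σ` is the geodesic `σ_{p,z}` from `p ∈ X` to `z ∈ X ∪ ∂X`; if `z` lies in `X`, it is continued
by the constant `z` after its arrival. -/
def IsGeodesicTo {X : Type*} [MetricSpace X] (σ : ℝ≥0 → X) (p : X) : Compactification X → Prop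
  | .pt y => σ 0 = p ∧
      (∀ s t : ℝ≥0, (s : ℝ) ≤ dist p y → (t : ℝ) ≤ dist p y → dist (σ s) (σ t) = dist s t) ∧
      ∀ t : ℝ≥0, dist p y ≤ (t : ℝ) → σ t = y
  | .bd ξ => ∃ τ : GeodesicRay X, τ.toFun = σ ∧ σ 0 = p ∧ τ.endpoint = ξ

/-- The cone topology on `X ∪ ∂X`: the coarsest topology for which all the maps `z ↦ σ_{p,z}(t)`
with `p ∈ X` and `t ≥ 0` are continuous (in a Hadamard space `σ_{p,z}` exists and is unique). -/
instance (X : Type*) [MetricSpace X] : TopologicalSpace (Compactification X) :=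
  TopologicalSpace.generateFrom
    {S | ∃ (p : X) (t : ℝ≥0) (U : Set X), IsOpen U ∧
      S = {z | ∃ σ : ℝ≥0 → X, IsGeodesicTo σ p z ∧ σ t ∈ U}}

/-- A parametrized geodesic line: an isometric map `ℝ → X`. -/
structure GeodesicLine (X : Type*) [MetricSpace X] where
  toFun : ℝ → X
  isometry : Isometry toFun

instance (X : Type*) [MetricSpace X] : CoeFun (GeodesicLine X) (fun _ => ℝ → X) :=
  ⟨GeodesicLine.toFun⟩

namespace GeodesicLine

variable {X : Type*} [MetricSpace X]

/-- The positive half of a line. -/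
def posRay (v : GeodesicLine X) : GeodesicRay X where
  toFun t := v (t : ℝ)
  isometry := Isometry.of_dist_eq fun s t => by rw [v.isometry.dist_eq, NNReal.dist_eq, Real.dist_eq]

/-- The negative half of a line. -/
def negRay (v : GeodesicLine X) : GeodesicRay X where
  toFun t := v (-(t : ℝ))
  isometry := Isometry.of_dist_eq fun s t => by
    rw [v.isometry.dist_eq, dist_neg_neg, NNReal.dist_eq, Real.dist_eq]

/-- The end point `v⁺`. -/
def pos (v : GeodesicLine X) : Boundary X := v.posRay.endpoint

/-- The end point `v⁻`. -/
def neg (v : GeodesicLine X) : Boundary X := v.negRay.endpoint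

/-- The geodesic flow `(g^s v)(t) = v(t + s)`. -/
def flow (s : ℝ) (v : GeodesicLine X) : GeodesicLine X where
  toFun t := v (t + s)
  isometry := Isometry.of_dist_eq fun a b => by rw [v.isometry.dist_eq, dist_add_right]

/-- The action of an isometry of `X` on lines. -/
def translate (g : X ≃ᵢ X) (v : GeodesicLine X) : GeodesicLine X where
  toFun t := g (v t)
  isometry := g.isometry.comp v.isometry

/-- The metric `d₁(u,v) = sup_t e^{-|t|} d(u(t),v(t))` on the set of lines. -/
noncomputable def d₁ (u v : GeodesicLine X) : ℝ :=
  ⨆ t : ℝ, Real.exp (-|t|) * dist (v t) (u t)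

/-- The supremum defining `d₁` is that of a bounded set. -/
theorem bddAbove_d₁ (u v : GeodesicLine X) :
    BddAbove (range fun t : ℝ => Real.exp (-|t|) * dist (v t) (u t)) := by
  refine ⟨dist (v 0) (u 0) + 2, ?_⟩
  rintro _ ⟨t, rfl⟩
  have h1 : dist (v t) (u t) ≤ |t| + dist (v 0) (u 0) + |t| := by
    have := dist_triangle4 (v t) (v 0) (u 0) (u t)
    rw [v.isometry.dist_eq, u.isometry.dist_eq, Real.dist_eq, Real.dist_eq] at this
    simpa using this
  have h2 : Real.exp (-|t|) ≤ 1 := Real.exp_le_one_iff.2 (by simp)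
  have h3 : Real.exp (-|t|) * |t| ≤ 1 := by
    have h4 : |t| ≤ Real.exp |t| := by linarith [Real.add_one_le_exp |t|]
    calc Real.exp (-|t|) * |t| ≤ Real.exp (-|t|) * Real.exp |t| := by gcongr
      _ = 1 := by rw [← Real.exp_add]; simp
  have h5 : 0 ≤ dist (v 0) (u 0) := dist_nonneg
  have h6 : 0 < Real.exp (-|t|) := Real.exp_pos _
  show Real.exp (-|t|) * dist (v t) (u t) ≤ _
  nlinarith [mul_le_mul_of_nonneg_left h1 h6.le, mul_le_mul_of_nonneg_right h2 h5]

end GeodesicLine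

/-- The Busemann function `B_ξ(x,y) = lim_{s → ∞} (d(x,σ(s)) - d(y,σ(s)))`, for a ray `σ` in the
class `ξ` (the limit does not depend on the ray when `X` is a Hadamard space). -/
noncomputable def busemann {X : Type*} [MetricSpace X] (ξ : Boundary X) (x y : X) : ℝ :=
  limUnder atTop fun s : ℝ≥0 =>
    dist x ((Quotient.out ξ : GeodesicRay X) s) - dist y ((Quotient.out ξ : GeodesicRay X) s)

/-- The limit defining the Busemann function exists. -/
theorem tendsto_busemann {X : Type*} [MetricSpace X] (ξ : Boundary X) (x y : X) :
    Tendsto (fun s : ℝ≥0 =>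
      dist x ((Quotient.out ξ : GeodesicRay X) s) - dist y ((Quotient.out ξ : GeodesicRay X) s))
      atTop (𝓝 (busemann ξ x y)) := by
  refine tendsto_nhds_limUnder ?_
  set σ : GeodesicRay X := Quotient.out ξ
  have key : ∀ w : X, ∃ l, Tendsto (fun s : ℝ≥0 => dist w (σ s) - s) atTop (𝓝 l) := by
    intro w
    refine ⟨_, tendsto_atTop_ciInf (f := fun s : ℝ≥0 => dist w (σ s) - (s : ℝ)) ?_ ?_⟩
    · intro s t hst
      have h1 := dist_triangle w (σ s) (σ t)
      rw [σ.isometry.dist_eq, NNReal.dist_eq, abs_sub_comm,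
        abs_of_nonneg (sub_nonneg.2 (NNReal.coe_le_coe.2 hst))] at h1
      show dist w (σ t) - (t : ℝ) ≤ dist w (σ s) - (s : ℝ)
      linarith
    · refine ⟨-dist w (σ 0), ?_⟩
      rintro _ ⟨s, rfl⟩
      have h1 := dist_triangle_left (σ 0) (σ s) w
      rw [σ.isometry.dist_eq, NNReal.dist_eq] at h1
      have h2 : ((s : ℝ≥0) : ℝ) ≤ |((0 : ℝ≥0) : ℝ) - (s : ℝ)| := by
        rw [abs_sub_comm]; simp
      show -dist w (σ 0) ≤ dist w (σ s) - (s : ℝ)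
      linarith
  obtain ⟨a, ha⟩ := key x
  obtain ⟨b, hb⟩ := key y
  exact ⟨a - b, (ha.sub hb).congr fun s => by ring⟩

namespace GeodesicLine

variable {X : Type*} [MetricSpace X]

/-- The Hopf parametrization `H_x(v) = (v⁻, v⁺, B_{v⁻}(v(0), x))`. -/
noncomputable def hopf (x : X) (v : GeodesicLine X) : Boundary X × Boundary X × ℝ :=
  (v.neg, v.pos, busemann v.neg (v 0) x)

/-- The relation `u ∼ v` : equal Hopf parameters (with respect to any base point). -/
def HopfEquiv (u v : GeodesicLine X) : Prop := ∀ x : X, hopf x u = hopf x v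

/-- The width of `v`: the supremum of `d(u(0),w(0))` over `u, w ∼ v`; it may be infinite. -/
noncomputable def width (v : GeodesicLine X) : ℝ≥0∞ :=
  ⨆ (u : GeodesicLine X) (_ : HopfEquiv u v) (w : GeodesicLine X) (_ : HopfEquiv w v),
    edist (u 0) (w 0)

/-- `v` is rank one: its width is finite. -/
def IsRankOne (v : GeodesicLine X) : Prop := v.width < ⊤

/-- `v` is rank one of zero width. -/
def IsZeroWidth (v : GeodesicLine X) : Prop := v.IsRankOne ∧ v.width = 0

/-- `v` `G`-accumulates on `u`: there are `g_n ∈ G` and `t_n → ∞` with `g_n g^{t_n} v → u`. -/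
def AccumulatesOn (G : Subgroup (X ≃ᵢ X)) (v u : GeodesicLine X) : Prop :=
  ∃ (g : ℕ → X ≃ᵢ X) (t : ℕ → ℝ), (∀ n, g n ∈ G) ∧ Tendsto t atTop atTop ∧
    Tendsto (fun n => d₁ (translate (g n) (flow (t n) v)) u) atTop (𝓝 0)

/-- `v` is `G`-recurrent. -/
def IsRecurrent (G : Subgroup (X ≃ᵢ X)) (v : GeodesicLine X) : Prop := AccumulatesOn G v v

end GeodesicLine

/-- `∂X^rec`: the points `v⁺` for `v` a zero width line which is recurrent for the full isometry
group of `X`. -/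
def recBoundary (X : Type*) [MetricSpace X] : Set (Boundary X) :=
  {η | ∃ v : GeodesicLine X, v.IsZeroWidth ∧ v.IsRecurrent ⊤ ∧ η = v.pos}

/-- `(ξη)`: the points of `X` which lie on a line from `ξ` to `η`. -/
def joinSet {X : Type*} [MetricSpace X] (ξ η : Boundary X) : Set X :=
  {p | ∃ v : GeodesicLine X, v.neg = ξ ∧ v.pos = η ∧ v 0 = p}

/-- The shadow `O_r(ξ,y)` with source `ξ ∈ ∂X`. -/
def shadow {X : Type*} [MetricSpace X] (r : ℝ) (ξ : Boundary X) (y : X) : Set (Boundary X) :=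
  {η | ∃ v : GeodesicLine X, v.neg = ξ ∧ v.pos = η ∧ v 0 ∈ Metric.ball y r}

/-- The set `∂̃O_r(ξ,y)` of those `η` that can be joined to `ξ` and satisfy `d(y,(ξη)) = r`. -/
def shadowFrontier {X : Type*} [MetricSpace X] (r : ℝ) (ξ : Boundary X) (y : X) :
    Set (Boundary X) :=
  {η | (∃ v : GeodesicLine X, v.neg = ξ ∧ v.pos = η) ∧ Metric.infDist y (joinSet ξ η) = r}

/-- The ray `σ_{z,η}` from `z ∈ X` to `η ∈ ∂X` (which exists and is unique in a Hadamard space)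
meets the open ball `B_r(y)`. -/
def RayMeetsBall {X : Type*} [MetricSpace X] (r : ℝ) (z : X) (η : Boundary X) (y : X) : Prop :=
  ∃ σ : GeodesicRay X, σ 0 = z ∧ σ.endpoint = η ∧ ∃ t : ℝ≥0, σ t ∈ Metric.ball y r

/-- The small shadow `O⁻_r(z,y)` with source `z ∈ X ∪ ∂X`. -/
def smallShadow {X : Type*} [MetricSpace X] (r : ℝ) (z : Compactification X) (y : X) :
    Set (Boundary X) :=
  match z with
  | .pt x => {η | ∀ x' ∈ Metric.ball x r, RayMeetsBall r x' η y}
  | .bd ξ => shadow r ξ y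

/-- The large shadow `O⁺_r(z,y)` with source `z ∈ X ∪ ∂X`. -/
def largeShadow {X : Type*} [MetricSpace X] (r : ℝ) (z : Compactification X) (y : X) :
    Set (Boundary X) :=
  match z with
  | .pt x => {η | ∃ x' ∈ Metric.ball x r, RayMeetsBall r x' η y}
  | .bd ξ => shadow r ξ y

end CAT0

open CAT0

/-!
Let `v` be a recurrent zero width line with `v⁺ = η`. Isometries `g_n` with `g_n v(· + t_n) → v`
take any other line ending at `η` to lines whose limit is parallel to `v`, hence is `v` up to a
shift; so every line ending at `η` is asymptotic to `v`, and by convexity of the distance at most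
one line joins a given `ξ` to `η`.

In a proper space, rays to `η` which start near points `z → ξ` and meet a fixed ball subconverge
to a line from `ξ` to `η`; this gives the upper bound. For the lower bound let `u` be the line
from `ξ` to `η`. If rays to `η` from points converging to `ξ` stayed at distance at least `ε` from
`u(0)`, then by the intermediate value theorem there would be points converging to `ξ` whose rays
to `η` pass at distance exactly `ε`. Their limit would be a line from `ξ` to `η` that misses
`u(0)`, contradicting uniqueness.
-/

namespace CAT0

section Isometric

variable {X : Type*} [MetricSpace X]

/-- `c` preserves distances on `S`. Geodesic segments, rays and lines are all handled as total maps
`ℝ → X` that are isometric on an interval, so that they can be restricted, shifted and reversed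
without changing their type. -/
def IsometricOn (c : ℝ → X) (S : Set ℝ) : Prop :=
  ∀ ⦃s⦄, s ∈ S → ∀ ⦃t⦄, t ∈ S → dist (c s) (c t) = |s - t|

namespace IsometricOn

variable {c : ℝ → X} {S T : Set ℝ}

theorem mono (h : IsometricOn c T) (hST : S ⊆ T) : IsometricOn c S :=
  fun _ hs _ ht => h (hST hs) (hST ht)

theorem comp_const_add (h : IsometricOn c S) (b : ℝ) (hT : MapsTo (b + ·) T S) :
    IsometricOn (fun t => c (b + t)) T := fun s hs t ht => by
  rw [h (hT hs) (hT ht), add_sub_add_left_eq_sub]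

theorem comp_const_sub (h : IsometricOn c S) (b : ℝ) (hT : MapsTo (b - ·) T S) :
    IsometricOn (fun t => c (b - t)) T := fun s hs t ht => by
  rw [h (hT hs) (hT ht), sub_sub_sub_cancel_left, abs_sub_comm]

theorem dist_zero_left (h : IsometricOn c S) (h0 : 0 ∈ S) {t : ℝ} (ht : t ∈ S) (ht0 : 0 ≤ t) :
    dist (c 0) (c t) = t := by
  rw [h h0 ht, zero_sub, abs_neg, abs_of_nonneg ht0]

theorem continuousOn (h : IsometricOn c S) : ContinuousOn c S := by
  refine LipschitzOnWith.continuousOn (K := 1) (LipschitzOnWith.of_dist_le_mul fun s hs t ht => ?_)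
  rw [h hs ht, Real.dist_eq, NNReal.coe_one, one_mul]

end IsometricOn

end Isometric

section Convexity

theorem exists_comparison_triangle {a b d : ℝ} (ha : 0 ≤ a) (hb : 0 ≤ b)
    (hd_le : d ≤ a + b) (ha_le : a ≤ b + d) (hb_le : b ≤ a + d) :
    ∃ q r : EuclideanSpace ℝ (Fin 2), ‖q‖ = a ∧ ‖r‖ = b ∧ dist q r = d := by
  have hd : 0 ≤ d := by linarith
  obtain ⟨x, hx, hxb⟩ : ∃ x, 2 * a * x = a ^ 2 + b ^ 2 - d ^ 2 ∧ |x| ≤ b := by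
    rcases ha.eq_or_lt with rfl | ha
    · obtain rfl : d = b := by linarith
      exact ⟨0, by ring, by simpa⟩
    · refine ⟨(a ^ 2 + b ^ 2 - d ^ 2) / (2 * a), by field_simp, abs_le.2 ⟨?_, ?_⟩⟩
      · rw [le_div_iff₀ (by positivity)]
        nlinarith [mul_nonneg (sub_nonneg.2 hd_le) (add_nonneg (add_nonneg ha.le hb) hd)]
      · rw [div_le_iff₀ (by positivity)]
        nlinarith [mul_nonneg (sub_nonneg.2 ha_le) (sub_nonneg.2 hb_le)]
  have hy : 0 ≤ b ^ 2 - x ^ 2 := sub_nonneg.2 (sq_le_sq' (abs_le.1 hxb).1 (abs_le.1 hxb).2)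
  refine ⟨!₂[a, 0], !₂[x, √(b ^ 2 - x ^ 2)], ?_, ?_, ?_⟩
  · simp [EuclideanSpace.norm_eq, Real.sqrt_sq_eq_abs, abs_of_nonneg ha]
  · simp [EuclideanSpace.norm_eq, Real.sq_sqrt hy, Real.sqrt_sq_eq_abs, abs_of_nonneg hb]
  · rw [EuclideanSpace.dist_eq, ← Real.sqrt_sq hd]
    congr 1
    simp only [Fin.sum_univ_two, Real.dist_eq, sq_abs, Matrix.cons_val_zero, Matrix.cons_val_one,
      Matrix.cons_val_fin_one, zero_sub, neg_sq, Real.sq_sqrt hy]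
    linarith

variable {X : Type*} [MetricSpace X] [HadamardSpace X] {c c' : ℝ → X} {a b l t : ℝ}

theorem exists_isometricOn (p q : X) :
    ∃ c : ℝ → X, c 0 = p ∧ c (dist p q) = q ∧ IsometricOn c (Icc 0 (dist p q)) := by
  obtain ⟨c, h0, h1, h⟩ := HadamardSpace.exists_geodesic p q
  exact ⟨c, h0, h1, fun s hs t ht => h s hs t ht⟩

theorem dist_le_mul_of_common_start (ha : 0 ≤ a) (hb : 0 ≤ b) (hc : IsometricOn c (Icc 0 a))
    (hc' : IsometricOn c' (Icc 0 b)) (h0 : c 0 = c' 0) (hl : l ∈ Icc (0 : ℝ) 1) :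
    dist (c (l * a)) (c' (l * b)) ≤ l * dist (c a) (c' b) := by
  have hpa : dist (c 0) (c a) = a := hc.dist_zero_left ⟨le_rfl, ha⟩ ⟨ha, le_rfl⟩ ha
  have hpb : dist (c 0) (c' b) = b := by
    rw [h0, hc'.dist_zero_left ⟨le_rfl, hb⟩ ⟨hb, le_rfl⟩ hb]
  obtain ⟨q, r, hq, hr, hqr⟩ := exists_comparison_triangle ha hb (d := dist (c a) (c' b))
    (by linarith [dist_triangle_left (c a) (c' b) (c 0)])
    (by linarith [dist_triangle_right (c 0) (c a) (c' b)])
    (by linarith [dist_triangle (c 0) (c a) (c' b)])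
  have mem_segment (q : EuclideanSpace ℝ (Fin 2)) : l • q ∈ segment ℝ 0 q := by
    rw [segment_eq_image]
    exact ⟨l, hl, by simp⟩
  have norm_smul_eq (q : EuclideanSpace ℝ (Fin 2)) : dist 0 (l • q) = l * ‖q‖ := by
    rw [dist_zero_left, norm_smul, Real.norm_of_nonneg hl.1]
  have mem_Icc {a : ℝ} (ha : 0 ≤ a) : l * a ∈ Icc 0 a :=
    ⟨mul_nonneg hl.1 ha, mul_le_of_le_one_left ha hl.2⟩
  have key := HadamardSpace.cat_zero (c 0) (c a) (c' b) c c'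
    ⟨rfl, by rw [hpa], by rw [hpa]; exact fun s hs t ht => hc hs ht⟩
    ⟨h0.symm, by rw [hpb], by rw [hpb]; exact fun s hs t ht => hc' hs ht⟩
    0 q r (by rw [dist_zero_left, hq, hpa]) (by rw [dist_zero_left, hr, hpb]) hqr
    (l * a) (by rw [hpa]; exact mem_Icc ha) (l * b) (by rw [hpb]; exact mem_Icc hb)
    (l • q) (mem_segment q) (l • r) (mem_segment r)
    (by rw [norm_smul_eq, hq]) (by rw [norm_smul_eq, hr])
  rwa [dist_smul₀, hqr, Real.norm_of_nonneg hl.1] at key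

theorem dist_le_of_common_start (hc : IsometricOn c (Icc 0 a)) (hc' : IsometricOn c' (Icc 0 a))
    (h0 : c 0 = c' 0) (ht : t ∈ Icc 0 a) : dist (c t) (c' t) ≤ t / a * dist (c a) (c' a) := by
  have ha := ht.1.trans ht.2
  have h := dist_le_mul_of_common_start ha ha hc hc' h0 (l := t / a)
    ⟨div_nonneg ht.1 ha, div_le_one_of_le₀ ht.2 ha⟩
  rwa [div_mul_cancel_of_imp fun h0 => le_antisymm (h0 ▸ ht.2) ht.1] at h

theorem dist_le_convex (ha : 0 ≤ a) (hb : 0 ≤ b) (hc : IsometricOn c (Icc 0 a))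
    (hc' : IsometricOn c' (Icc 0 b)) (hl : l ∈ Icc (0 : ℝ) 1) :
    dist (c (l * a)) (c' (l * b)) ≤ (1 - l) * dist (c 0) (c' 0) + l * dist (c a) (c' b) := by
  obtain ⟨e, he0, hem, he⟩ := exists_isometricOn (c 0) (c' b)
  set m := dist (c 0) (c' b) with hm
  have maps_Icc (m : ℝ) : MapsTo (m - ·) (Icc 0 m) (Icc 0 m) :=
    fun t ht => ⟨sub_nonneg.2 ht.2, sub_le_self m ht.1⟩
  -- Compare both sides with the diagonal `e` of the quadrilateral.
  have hce : dist (c (l * a)) (e (l * m)) ≤ l * dist (c a) (c' b) := by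
    have h := dist_le_mul_of_common_start ha dist_nonneg hc he he0.symm hl
    rwa [← hm, hem] at h
  have hec' := dist_le_mul_of_common_start dist_nonneg hb (he.comp_const_sub m (maps_Icc m))
    (hc'.comp_const_sub b (maps_Icc b)) (by simp only [sub_zero, hem])
    (l := 1 - l) ⟨sub_nonneg.2 hl.2, sub_le_self 1 hl.1⟩
  rw [← hm] at hec'
  simp only [sub_self, he0] at hec'
  rw [show m - (1 - l) * m = l * m by ring, show b - (1 - l) * b = l * b by ring] at hec'
  linarith [dist_triangle (c (l * a)) (e (l * m)) (c' (l * b))]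

theorem dist_le_fellow_travel (hb : 0 ≤ b) (hc : IsometricOn c (Icc 0 a))
    (hc' : IsometricOn c' (Icc 0 b)) (ht : t ∈ Icc 0 a) (htb : t ≤ b) :
    dist (c t) (c' t) ≤ dist (c 0) (c' 0) + 2 * (t / a) * dist (c a) (c' b) := by
  have ha := ht.1.trans ht.2
  set l := t / a
  have hl : l ∈ Icc (0 : ℝ) 1 := ⟨div_nonneg ht.1 ha, div_le_one_of_le₀ ht.2 ha⟩
  have hla : l * a = t := div_mul_cancel_of_imp fun h0 => le_antisymm (h0 ▸ ht.2) ht.1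
  have hconvex := dist_le_convex ha hb hc hc' hl
  have hreparam : dist (c' (l * b)) (c' t) = l * |b - a| := by
    rw [hc' ⟨mul_nonneg hl.1 hb, mul_le_of_le_one_left hb hl.2⟩ ⟨ht.1, htb⟩, ← hla, ← mul_sub,
      abs_mul, abs_of_nonneg hl.1]
  have hlength : |b - a| ≤ dist (c 0) (c' 0) + dist (c a) (c' b) := by
    have hca := hc.dist_zero_left ⟨le_rfl, ha⟩ ⟨ha, le_rfl⟩ ha
    have hcb := hc'.dist_zero_left ⟨le_rfl, hb⟩ ⟨hb, le_rfl⟩ hb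
    have h := dist_dist_dist_le (c' 0) (c' b) (c 0) (c a)
    rwa [hca, hcb, Real.dist_eq, dist_comm (c' 0), dist_comm (c' b)] at h
  rw [hla] at hconvex
  nlinarith [dist_triangle (c t) (c' (l * b)) (c' t), mul_le_mul_of_nonneg_left hlength hl.1]

theorem dist_le_of_bounded (hc : IsometricOn c (Ici 0)) (hc' : IsometricOn c' (Ici 0)) {C : ℝ}
    (hC : ∀ s, 0 ≤ s → dist (c s) (c' s) ≤ C) (ht : 0 ≤ t) :
    dist (c t) (c' t) ≤ dist (c 0) (c' 0) := by
  have hlim : Tendsto (fun a : ℝ => dist (c 0) (c' 0) + 2 * (t / a) * C) atTop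
      (𝓝 (dist (c 0) (c' 0) + 2 * 0 * C)) :=
    tendsto_const_nhds.add (((tendsto_const_nhds.div_atTop tendsto_id).const_mul 2).mul_const C)
  rw [mul_zero, zero_mul, add_zero] at hlim
  refine ge_of_tendsto hlim ?_
  filter_upwards [eventually_ge_atTop t] with a hta
  have ha := ht.trans hta
  have h := dist_le_fellow_travel ha (hc.mono Icc_subset_Ici_self) (hc'.mono Icc_subset_Ici_self)
    ⟨ht, hta⟩ hta
  have := hC a ha
  exact h.trans (by gcongr)

end Convexity

section EndPoints

variable {X : Type*} [MetricSpace X]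

/-- The curve `c` runs, for `t ≥ 0`, at bounded distance from the rays of the class `η`. For a
geodesic ray this says that its end point is `η`. -/
def EndsAt (c : ℝ → X) (η : Boundary X) : Prop :=
  ∃ C : ℝ, ∀ t : ℝ≥0, dist (c t) ((Quotient.out η : GeodesicRay X) t) ≤ C

namespace EndsAt

variable {c c' : ℝ → X} {η : Boundary X} {C : ℝ}

theorem of_dist_le (h : EndsAt c η) (hC : ∀ t, 0 ≤ t → dist (c' t) (c t) ≤ C) : EndsAt c' η := by
  obtain ⟨D, hD⟩ := h
  exact ⟨C + D, fun t => (dist_triangle _ _ _).trans (add_le_add (hC t t.2) (hD t))⟩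

theorem exists_dist_le (h : EndsAt c η) (h' : EndsAt c' η) :
    ∃ C : ℝ, ∀ t, 0 ≤ t → dist (c t) (c' t) ≤ C := by
  obtain ⟨C, hC⟩ := h
  obtain ⟨D, hD⟩ := h'
  exact ⟨C + D, fun t ht => (dist_triangle_right _ _ _).trans
    (add_le_add (hC ⟨t, ht⟩) (hD ⟨t, ht⟩))⟩

theorem comp_const_add (h : EndsAt c η) (hc : IsometricOn c (Ici 0)) {b : ℝ} (hb : 0 ≤ b) :
    EndsAt (fun t => c (b + t)) η :=
  h.of_dist_le (C := b) fun t ht => by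
    rw [hc (add_nonneg hb ht) ht, add_sub_cancel_right, abs_of_nonneg hb]

theorem of_tendsto {ι : Type*} {l : Filter ι} [l.NeBot] {f : ι → ℝ → X} (h : EndsAt c η)
    (hf : ∀ t, 0 ≤ t → Tendsto (fun n => f n t) l (𝓝 (c' t)))
    (hC : ∀ t, 0 ≤ t → ∀ᶠ n in l, dist (f n t) (c t) ≤ C) : EndsAt c' η :=
  h.of_dist_le fun t ht => le_of_tendsto ((hf t ht).dist tendsto_const_nhds) (hC t ht)

end EndsAt

namespace GeodesicRay

/-- The ray `σ` as a total map on `ℝ`, constant for `t ≤ 0`. -/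
def extend (σ : GeodesicRay X) (t : ℝ) : X := σ t.toNNReal

/-- The ray given by a total map that is isometric on `[0,∞)`. -/
def ofCurve (c : ℝ → X) (hc : IsometricOn c (Ici 0)) : GeodesicRay X where
  toFun t := c t
  isometry := Isometry.of_dist_eq fun s t => hc s.2 t.2

theorem isometricOn_extend (σ : GeodesicRay X) : IsometricOn σ.extend (Ici 0) := by
  intro s hs t ht
  rw [extend, extend, σ.isometry.dist_eq, NNReal.dist_eq, Real.coe_toNNReal _ hs,
    Real.coe_toNNReal _ ht]

theorem endpoint_eq_iff {σ : GeodesicRay X} {η : Boundary X} :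
    σ.endpoint = η ↔ ∃ C : ℝ, ∀ t : ℝ≥0, dist (σ t) ((Quotient.out η : GeodesicRay X) t) ≤ C :=
  Quotient.mk_eq_iff_out

theorem endsAt_extend_iff {σ : GeodesicRay X} {η : Boundary X} :
    EndsAt σ.extend η ↔ σ.endpoint = η := by
  simp only [endpoint_eq_iff, EndsAt, extend, Real.toNNReal_coe]

theorem endpoint_ofCurve_eq_iff {c : ℝ → X} {hc : IsometricOn c (Ici 0)} {η : Boundary X} :
    (ofCurve c hc).endpoint = η ↔ EndsAt c η :=
  endpoint_eq_iff

end GeodesicRay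

namespace GeodesicLine

/-- The line `v` with the opposite orientation. -/
def reverse (v : GeodesicLine X) : GeodesicLine X where
  toFun t := v (-t)
  isometry := Isometry.of_dist_eq fun s t => by rw [v.isometry.dist_eq, dist_neg_neg]

variable {u v : GeodesicLine X} {η : Boundary X}

theorem isometricOn (v : GeodesicLine X) (S : Set ℝ) : IsometricOn v S := fun s _ t _ => by
  rw [v.isometry.dist_eq, Real.dist_eq]

theorem reverse_apply (v : GeodesicLine X) (t : ℝ) : v.reverse t = v (-t) := rfl

theorem flow_apply (s : ℝ) (v : GeodesicLine X) (t : ℝ) : flow s v t = v (t + s) := rfl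

theorem endsAt_iff_pos_eq : EndsAt v η ↔ v.pos = η :=
  (GeodesicRay.endpoint_eq_iff (σ := v.posRay)).symm

theorem endsAt_reverse_iff_neg_eq : EndsAt v.reverse η ↔ v.neg = η :=
  endsAt_iff_pos_eq

theorem endsAt_pos (v : GeodesicLine X) : EndsAt v v.pos :=
  endsAt_iff_pos_eq.2 rfl

theorem endsAt_neg (v : GeodesicLine X) : EndsAt v.reverse v.neg :=
  v.reverse.endsAt_pos

theorem pos_flow (s : ℝ) (v : GeodesicLine X) : (flow s v).pos = v.pos :=
  endsAt_iff_pos_eq.1 <| v.endsAt_pos.of_dist_le (C := |s|) fun t _ => by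
    rw [flow_apply, v.isometry.dist_eq, Real.dist_eq, add_sub_cancel_left]

theorem neg_flow (s : ℝ) (v : GeodesicLine X) : (flow s v).neg = v.neg :=
  endsAt_reverse_iff_neg_eq.1 <| v.endsAt_neg.of_dist_le (C := |s|) fun t _ => by
    rw [reverse_apply, reverse_apply, flow_apply, v.isometry.dist_eq, Real.dist_eq,
      add_sub_cancel_left]

end GeodesicLine

variable [HadamardSpace X]

theorem EndsAt.dist_le {c c' : ℝ → X} {η : Boundary X} (h : EndsAt c η) (h' : EndsAt c' η)
    (hc : IsometricOn c (Ici 0)) (hc' : IsometricOn c' (Ici 0)) {t : ℝ} (ht : 0 ≤ t) :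
    dist (c t) (c' t) ≤ dist (c 0) (c' 0) := by
  obtain ⟨C, hC⟩ := h.exists_dist_le h'
  exact dist_le_of_bounded hc hc' hC ht

namespace GeodesicLine

variable {u v : GeodesicLine X}

theorem antitone_dist (h : u.pos = v.pos) : Antitone fun t => dist (u t) (v t) := by
  intro s t hst
  have hdist := EndsAt.dist_le (c := flow s u) (c' := flow s v) (flow s u).endsAt_pos
    (endsAt_iff_pos_eq.2 (by rw [pos_flow, pos_flow, h])) (isometricOn _ _) (isometricOn _ _)
    (sub_nonneg.2 hst)
  simpa only [flow_apply, sub_add_cancel, zero_add] using hdist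

theorem monotone_dist (h : u.neg = v.neg) : Monotone fun t => dist (u t) (v t) := by
  intro s t hst
  have hdist := antitone_dist (u := u.reverse) (v := v.reverse) h (neg_le_neg hst)
  simpa only [reverse_apply, neg_neg] using hdist

end GeodesicLine

end EndPoints

section UltrafilterLimits

variable {X : Type*} [MetricSpace X] [ProperSpace X] {ι : Type*}

theorem exists_isometricOn_limit (U : Ultrafilter ι) {f : ι → ℝ → X} {S : Set ℝ} (h0 : 0 ∈ S)
    (hf : ∀ T, ∀ᶠ n in U, IsometricOn (f n) (S ∩ Icc (-T) T)) {p : X} {R : ℝ}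
    (hR : ∀ᶠ n in U, dist (f n 0) p ≤ R) :
    ∃ w : ℝ → X, IsometricOn w S ∧ ∀ t ∈ S, Tendsto (fun n => f n t) U (𝓝 (w t)) := by
  have hlim : ∀ t ∈ S, ∃ y, Tendsto (fun n => f n t) U (𝓝 y) := by
    intro t ht
    have hbounded : ∀ᶠ n in U, f n t ∈ Metric.closedBall p (|t| + R) := by
      filter_upwards [hf |t|, hR] with n hn hnR
      have hdist := hn ⟨ht, abs_le.1 le_rfl⟩ ⟨h0, abs_le.1 (by simp)⟩
      rw [sub_zero] at hdist
      rw [Metric.mem_closedBall]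
      linarith [dist_triangle (f n t) (f n 0) p]
    obtain ⟨y, -, hy⟩ := (isCompact_closedBall p (|t| + R)).ultrafilter_le_nhds'
      (U.map fun n => f n t) hbounded
    exact ⟨y, hy⟩
  have : Nonempty X := ⟨p⟩
  choose! w hw using hlim
  refine ⟨w, fun s hs t ht => ?_, hw⟩
  refine tendsto_nhds_unique ((hw s hs).dist (hw t ht)) (tendsto_const_nhds.congr' ?_)
  filter_upwards [hf (max |s| |t|)] with n hn
  exact (hn ⟨hs, abs_le.1 (le_max_left _ _)⟩ ⟨ht, abs_le.1 (le_max_right _ _)⟩).symm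

theorem exists_line_limit (U : Ultrafilter ι) {f : ι → ℝ → X} {ξ η : Boundary X} {C : ℝ}
    {ζ ρ : ℝ → X} (hζ : EndsAt ζ ξ) (hρ : EndsAt ρ η)
    (hf : ∀ T, ∀ᶠ n in U, IsometricOn (f n) (Ici (-T)))
    (hfζ : ∀ t, 0 ≤ t → ∀ᶠ n in U, dist (f n (-t)) (ζ t) ≤ C)
    (hfρ : ∀ t, 0 ≤ t → ∀ᶠ n in U, dist (f n t) (ρ t) ≤ C) :
    ∃ w : GeodesicLine X, w.neg = ξ ∧ w.pos = η ∧ ∀ t, Tendsto (fun n => f n t) U (𝓝 (w t)) := by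
  obtain ⟨w, hw, hlim⟩ := exists_isometricOn_limit U (mem_univ 0)
    (fun T => (hf T).mono fun _ h => h.mono fun _ ht => ht.2.1) (hfρ 0 le_rfl)
  have hlim (t : ℝ) := hlim t trivial
  exact ⟨⟨w, Isometry.of_dist_eq fun s t => hw trivial trivial⟩,
    GeodesicLine.endsAt_reverse_iff_neg_eq.1 (hζ.of_tendsto (fun t _ => hlim (-t)) hfζ),
    GeodesicLine.endsAt_iff_pos_eq.1 (hρ.of_tendsto (fun t _ => hlim t) hfρ), hlim⟩

end UltrafilterLimits

section Rays

variable {X : Type*} [MetricSpace X] [ProperSpace X] [HadamardSpace X]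

theorem exists_ray (p : X) (η : Boundary X) :
    ∃ c : ℝ → X, IsometricOn c (Ici 0) ∧ c 0 = p ∧ EndsAt c η := by
  obtain ⟨τ, rfl⟩ : ∃ τ : GeodesicRay X, τ.endpoint = η := Quotient.exists_rep η
  have hτ := τ.isometricOn_extend
  choose c hc0 hcn hc using fun n : ℕ => exists_isometricOn p (τ.extend n)
  set D := dist p (τ.extend 0)
  have hlength (n : ℕ) : (n : ℝ) - D ≤ dist p (τ.extend n) := by
    have := hτ.dist_zero_left self_mem_Ici (mem_Ici.2 n.cast_nonneg) n.cast_nonneg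
    linarith [dist_triangle_left (τ.extend 0) (τ.extend n) p]
  have hfar (T : ℝ) : ∀ᶠ n : ℕ in hyperfilter ℕ, T ≤ n ∧ T ≤ dist p (τ.extend n) := by
    refine Eventually.filter_mono Nat.hyperfilter_le_atTop ?_
    filter_upwards [tendsto_natCast_atTop_atTop.eventually_ge_atTop (T + D)] with n hn
    have hD : 0 ≤ D := dist_nonneg
    exact ⟨by linarith, by linarith [hlength n]⟩
  obtain ⟨w, hw, hlim⟩ := exists_isometricOn_limit (hyperfilter ℕ) (S := Ici 0) self_mem_Ici
    (fun T => (hfar T).mono fun n hn => (hc n).mono fun t ht => ⟨ht.1, ht.2.2.trans hn.2⟩)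
    (R := 0) (Eventually.of_forall fun n => dist_le_zero.2 (hc0 n))
  have hclose (t : ℝ) (ht : 0 ≤ t) : ∀ᶠ n in hyperfilter ℕ, dist (c n t) (τ.extend t) ≤ D := by
    filter_upwards [hfar t] with n hn
    have h := dist_le_fellow_travel n.cast_nonneg (hc n) (hτ.mono Icc_subset_Ici_self)
      ⟨ht, hn.2⟩ hn.1
    rwa [hc0, hcn, dist_self, mul_zero, add_zero] at h
  have hw0 : w 0 = p := tendsto_nhds_unique (hlim 0 self_mem_Ici)
    (tendsto_const_nhds.congr fun n => (hc0 n).symm)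
  exact ⟨w, hw, hw0, (GeodesicRay.endsAt_extend_iff.2 rfl).of_tendsto hlim hclose⟩

/-- The ray `σ_{p,η}` from `p` to `η`, as a total map of which only the values on `[0,∞)` are
meaningful. -/
noncomputable def ray (p : X) (η : Boundary X) : ℝ → X := (exists_ray p η).choose

theorem isometricOn_ray (p : X) (η : Boundary X) : IsometricOn (ray p η) (Ici 0) :=
  (exists_ray p η).choose_spec.1

theorem ray_zero (p : X) (η : Boundary X) : ray p η 0 = p :=
  (exists_ray p η).choose_spec.2.1

theorem endsAt_ray (p : X) (η : Boundary X) : EndsAt (ray p η) η :=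
  (exists_ray p η).choose_spec.2.2

end Rays

section Busemann

variable {X : Type*} [MetricSpace X]

theorem busemann_add (ξ : Boundary X) (x y z : X) :
    busemann ξ x y + busemann ξ y z = busemann ξ x z :=
  tendsto_nhds_unique (((tendsto_busemann ξ x y).add (tendsto_busemann ξ y z)).congr
    fun s => by ring) (tendsto_busemann ξ x z)

theorem busemann_le_dist (ξ : Boundary X) (x y : X) : busemann ξ x y ≤ dist x y :=
  le_of_tendsto' (tendsto_busemann ξ x y) fun s => by
    linarith [dist_triangle x y ((Quotient.out ξ : GeodesicRay X) s)]

theorem continuous_busemann (ξ : Boundary X) (y : X) : Continuous fun x => busemann ξ x y := by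
  refine (LipschitzWith.of_le_add fun a b => ?_ : LipschitzWith 1 _).continuous
  rw [← busemann_add ξ a b y, add_comm]
  exact add_le_add_right (busemann_le_dist ξ a b) _

namespace GeodesicLine

theorem exists_abs_busemann_sub_le (w : GeodesicLine X) :
    ∃ C, ∀ a, |busemann w.neg (w a) (w 0) - a| ≤ C := by
  obtain ⟨C, hC⟩ := w.endsAt_neg
  refine ⟨2 * C, fun a =>
    le_of_tendsto ((tendsto_busemann w.neg (w a) (w 0)).sub_const a).abs ?_⟩
  filter_upwards [eventually_ge_atTop (-a).toNNReal] with s hs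
  set q := (Quotient.out w.neg : GeodesicRay X) s
  have hq : dist (w (-s)) q ≤ C := hC s
  have has : dist (w a) (w (-s)) = a + s := by
    rw [w.isometry.dist_eq, Real.dist_eq, sub_neg_eq_add, abs_of_nonneg]
    linarith [Real.toNNReal_le_iff_le_coe.1 hs]
  have h0s : dist (w 0) (w (-s)) = s := by
    rw [w.isometry.dist_eq, Real.dist_eq, sub_neg_eq_add, zero_add, NNReal.abs_eq]
  rw [abs_le]
  constructor <;> linarith [dist_triangle (w a) (w (-s)) q, dist_triangle (w 0) (w (-s)) q,
    dist_triangle_right (w a) (w (-s)) q, dist_triangle_right (w 0) (w (-s)) q]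

theorem exists_busemann_eq_zero (w : GeodesicLine X) (y : X) :
    ∃ a, busemann w.neg (w a) y = 0 := by
  obtain ⟨C, hC⟩ := w.exists_abs_busemann_sub_le
  have hsum (a : ℝ) :
      busemann w.neg (w a) (w 0) + busemann w.neg (w 0) y = busemann w.neg (w a) y :=
    busemann_add _ _ _ _
  set B := busemann w.neg (w 0) y
  refine mem_range_of_exists_le_of_exists_ge
    ((continuous_busemann w.neg y).comp w.isometry.continuous) ⟨-(C + B), ?_⟩ ⟨C - B, ?_⟩
  · linarith [(abs_le.1 (hC (-(C + B)))).2, hsum (-(C + B))]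
  · linarith [(abs_le.1 (hC (C - B))).1, hsum (C - B)]

end GeodesicLine

end Busemann

section Recurrence

namespace GeodesicLine

section Metric

variable {X : Type*} [MetricSpace X]

theorem dist_le_exp_mul_d₁ (u v : GeodesicLine X) (t : ℝ) :
    dist (v t) (u t) ≤ Real.exp |t| * d₁ u v :=
  calc dist (v t) (u t) = Real.exp |t| * (Real.exp (-|t|) * dist (v t) (u t)) := by
        rw [← mul_assoc, ← Real.exp_add, add_neg_cancel, Real.exp_zero, one_mul]
    _ ≤ Real.exp |t| * d₁ u v := by
        gcongr
        exact le_ciSup (bddAbove_d₁ u v) t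

theorem AccumulatesOn.exists_tendsto_apply {G : Subgroup (X ≃ᵢ X)} {u v : GeodesicLine X}
    (h : AccumulatesOn G v u) : ∃ (g : ℕ → X ≃ᵢ X) (τ : ℕ → ℝ), Tendsto τ atTop atTop ∧
      ∀ s, Tendsto (fun n => g n (v (s + τ n))) atTop (𝓝 (u s)) := by
  obtain ⟨g, τ, -, hτ, hd₁⟩ := h
  refine ⟨g, τ, hτ, fun s => tendsto_iff_dist_tendsto_zero.2 ?_⟩
  have hbound := hd₁.const_mul (Real.exp |s|)
  rw [mul_zero] at hbound
  refine squeeze_zero (fun _ => dist_nonneg) (fun n => ?_) hbound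
  rw [dist_comm]
  exact dist_le_exp_mul_d₁ (translate (g n) (flow (τ n) v)) u s

end Metric

variable {X : Type*} [MetricSpace X] [HadamardSpace X] {u v : GeodesicLine X}

theorem IsZeroWidth.exists_flow_eq (hv : v.IsZeroWidth) {w : GeodesicLine X} (hn : w.neg = v.neg)
    (hp : w.pos = v.pos) : ∃ a, ∀ t, w (t + a) = v t := by
  -- Shift `w` onto the horosphere through `v 0`: the shifted line is then equivalent to `v`.
  obtain ⟨a, ha⟩ := w.exists_busemann_eq_zero (v 0)
  have hequiv : HopfEquiv (flow a w) v := by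
    intro x
    have hbusemann : busemann v.neg (w a) x = busemann v.neg (v 0) x := by
      rw [← busemann_add v.neg (w a) (v 0) x, ← hn, ha, zero_add]
    rw [hopf, hopf, pos_flow, neg_flow, hn, hp, flow_apply, zero_add, hbusemann]
  have hwidth : edist (flow a w 0) (v 0) ≤ v.width :=
    le_iSup₂_of_le (flow a w) hequiv (le_iSup₂_of_le v (fun _ => rfl) le_rfl)
  have h0 : dist (flow a w 0) (v 0) = 0 := by
    rwa [hv.2, nonpos_iff_eq_zero, edist_eq_zero, ← dist_eq_zero] at hwidth
  refine ⟨a, fun t => dist_le_zero.1 (?_ : dist (flow a w t) (v t) ≤ 0)⟩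
  rw [← h0]
  rcases le_total 0 t with ht | ht
  · exact antitone_dist ((pos_flow a w).trans hp) ht
  · exact monotone_dist ((neg_flow a w).trans hn) ht

variable [ProperSpace X]

theorem exists_line_tendsto_of_pos_eq {ι : Type*} (U : Ultrafilter ι) {g : ι → X ≃ᵢ X} {τ : ι → ℝ}
    {v' : GeodesicLine X} (hτ : Tendsto τ U atTop)
    (hv' : ∀ s, Tendsto (fun n => g n (v (s + τ n))) U (𝓝 (v' s))) (hp : u.pos = v.pos) :
    ∃ w : GeodesicLine X, w.neg = v'.neg ∧ w.pos = v'.pos ∧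
      ∀ s, Tendsto (fun n => g n (u (s + τ n))) U (𝓝 (w s)) := by
  have hbound (s : ℝ) : ∀ᶠ n in U, dist (g n (u (s + τ n))) (v' s) ≤ dist (u 0) (v 0) + 1 := by
    filter_upwards [(hv' s).eventually (Metric.closedBall_mem_nhds _ one_pos),
      hτ.eventually_ge_atTop (-s)] with n hn hτn
    have huv : dist (u (s + τ n)) (v (s + τ n)) ≤ dist (u 0) (v 0) :=
      antitone_dist hp (by linarith)
    rw [← (g n).isometry.dist_eq] at huv
    exact (dist_triangle _ _ _).trans (add_le_add huv hn)
  exact exists_line_limit U v'.endsAt_neg v'.endsAt_pos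
    (fun T => Eventually.of_forall fun n => isometricOn (translate (g n) (flow (τ n) u)) _)
    (fun t _ => hbound (-t)) (fun t _ => hbound t)

theorem AccumulatesOn.exists_tendsto_dist {G : Subgroup (X ≃ᵢ X)} (h : AccumulatesOn G v v)
    (hv : v.IsZeroWidth) (hp : u.pos = v.pos) :
    ∃ a, Tendsto (fun t => dist (u t) (v (t + a))) atTop (𝓝 0) := by
  obtain ⟨g, τ, hτ, hgv⟩ := h.exists_tendsto_apply
  have hU : (hyperfilter ℕ : Filter ℕ) ≤ atTop := Nat.hyperfilter_le_atTop
  obtain ⟨w, hwn, hwp, hgu⟩ := exists_line_tendsto_of_pos_eq (hyperfilter ℕ) (hτ.mono_left hU)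
    (fun s => (hgv s).mono_left hU) hp
  obtain ⟨a, ha⟩ := hv.exists_flow_eq hwn hwp
  have hw0 : w 0 = v (-a) := by rw [← ha, neg_add_cancel]
  have hzero : Tendsto (fun n => dist (u (τ n)) (v (τ n + -a))) (hyperfilter ℕ) (𝓝 0) := by
    have hlim := (hgu 0).dist ((hgv (-a)).mono_left hU)
    rw [hw0, dist_self] at hlim
    refine hlim.congr fun n => ?_
    rw [(g n).isometry.dist_eq, zero_add, add_comm]
  -- The distance decreases, so it suffices that it tends to `0` along the times `τ n`.
  have hanti : Antitone fun t => dist (u t) (v (t + -a)) :=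
    antitone_dist (v := flow (-a) v) (hp.trans (pos_flow _ _).symm)
  have hinf := tendsto_atTop_ciInf hanti ⟨0, forall_mem_range.2 fun _ => dist_nonneg⟩
  rw [← tendsto_nhds_unique hzero (hinf.comp (hτ.mono_left hU))] at hinf
  exact ⟨-a, hinf⟩

end GeodesicLine

/-- Up to parametrization there is at most one line from `ξ` to `η`: each such line runs through all
points of `(ξη)`. -/
def AtMostOneLine {X : Type*} [MetricSpace X] (ξ η : Boundary X) : Prop :=
  ∀ w : GeodesicLine X, w.neg = ξ → w.pos = η → joinSet ξ η ⊆ range w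

open GeodesicLine in
theorem atMostOneLine_of_mem_recBoundary {X : Type*} [MetricSpace X] [HadamardSpace X]
    [ProperSpace X] {η : Boundary X} (hη : η ∈ recBoundary X) (ξ : Boundary X) :
    AtMostOneLine ξ η := by
  rintro w rfl rfl _ ⟨u, hn, hp, rfl⟩
  obtain ⟨v, hv, hrec, hvp⟩ := hη
  obtain ⟨a, ha⟩ := hrec.exists_tendsto_dist hv (hp.trans hvp)
  obtain ⟨b, hb⟩ := hrec.exists_tendsto_dist hv hvp
  refine ⟨a - b, dist_le_zero.1 ?_⟩
  have hlim := (hb.comp (tendsto_atTop_add_const_right atTop (a - b) tendsto_id)).add ha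
  rw [add_zero] at hlim
  refine ge_of_tendsto hlim ?_
  filter_upwards [eventually_ge_atTop 0] with t ht
  calc dist (w (a - b)) (u 0) = dist (flow (a - b) w 0) (u 0) := by simp only [flow_apply, zero_add]
    _ ≤ dist (flow (a - b) w t) (u t) := monotone_dist ((neg_flow _ _).trans hn.symm) ht
    _ ≤ _ := dist_triangle_right _ _ (v (t + a))
    _ = _ := by simp only [flow_apply, Function.comp_apply, id_eq, add_assoc, sub_add_cancel]

end Recurrence

section ConeNeighbourhoods

variable {X : Type*} [MetricSpace X]

/-- `σ`, restricted to `[0,∞)`, is a geodesic to `z` that does not arrive before time `S`. -/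
def IsGeodesicBeyond (σ : ℝ → X) (S : ℝ) : Compactification X → Prop
  | .pt y => ∃ L, S ≤ L ∧ IsometricOn σ (Icc 0 L) ∧ σ L = y
  | .bd ξ => IsometricOn σ (Ici 0) ∧ EndsAt σ ξ

namespace IsGeodesicBeyond

variable {σ : ℝ → X} {S T : ℝ} {z : Compactification X}

theorem isometricOn (h : IsGeodesicBeyond σ S z) : IsometricOn σ (Icc 0 S) := by
  cases z with
  | pt y =>
    obtain ⟨L, hL, hσ, -⟩ := h
    exact hσ.mono (Icc_subset_Icc_right hL)
  | bd ξ => exact h.1.mono Icc_subset_Ici_self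

theorem anti (h : IsGeodesicBeyond σ S z) (hTS : T ≤ S) : IsGeodesicBeyond σ T z := by
  cases z with
  | pt y =>
    obtain ⟨L, hL, hσ⟩ := h
    exact ⟨L, hTS.trans hL, hσ⟩
  | bd ξ => exact h

end IsGeodesicBeyond

theorem IsGeodesicTo.isGeodesicBeyond {σ : ℝ≥0 → X} {p : X} {z : Compactification X}
    (h : IsGeodesicTo σ p z) (T : ℝ≥0) :
    IsGeodesicBeyond (fun t => σ t.toNNReal) (dist p (σ T)) z ∧
      σ (dist p (σ T)).toNNReal = σ T := by
  cases z with
  | pt y =>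
    obtain ⟨h0, hiso, hend⟩ := h
    have hσ : IsometricOn (fun t => σ t.toNNReal) (Icc 0 (dist p y)) := fun s hs t ht => by
      rw [hiso _ _ (by rw [Real.coe_toNNReal _ hs.1]; exact hs.2)
        (by rw [Real.coe_toNNReal _ ht.1]; exact ht.2), NNReal.dist_eq,
        Real.coe_toNNReal _ hs.1, Real.coe_toNNReal _ ht.1]
    have harrival : σ (dist p y).toNNReal = y := hend _ (Real.le_coe_toNNReal _)
    rcases le_total (T : ℝ) (dist p y) with hT | hT
    · have hdist : dist p (σ T) = T := by
        rw [← h0, hiso 0 T dist_nonneg hT, NNReal.dist_eq]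
        simp
      rw [hdist, Real.toNNReal_coe]
      exact ⟨⟨_, hT, hσ, harrival⟩, rfl⟩
    · rw [hend T hT]
      exact ⟨⟨_, le_rfl, hσ, harrival⟩, harrival⟩
  | bd ξ =>
    obtain ⟨τ, rfl, rfl, hτ⟩ := h
    refine ⟨⟨τ.isometricOn_extend, GeodesicRay.endsAt_extend_iff.2 hτ⟩, ?_⟩
    rw [τ.isometry.dist_eq, NNReal.dist_eq, NNReal.coe_zero, zero_sub, abs_neg, NNReal.abs_eq,
      Real.toNNReal_coe]

/-- The points `z` of `X ∪ ∂X` at distance at least `S` from `ζ(0)` such that the geodesic from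
`ζ(0)` to `z` is still `1`-close to `ζ` at time `S`. For a ray `ζ` these sets are neighbourhoods of
its end point in the cone topology. -/
def coneNhd (ζ : ℝ → X) (S : ℝ) : Set (Compactification X) :=
  {z | ∃ σ : ℝ → X, σ 0 = ζ 0 ∧ IsGeodesicBeyond σ S z ∧ dist (σ S) (ζ S) ≤ 1}

variable {ζ : ℝ → X} {S T : ℝ} {z : Compactification X}

theorem le_dist_of_pt_mem_coneNhd (hS : 0 ≤ S) {y : X} (hy : .pt y ∈ coneNhd ζ S) :
    S ≤ dist (ζ 0) y := by
  obtain ⟨σ, hσ0, ⟨L, hSL, hσ, rfl⟩, -⟩ := hy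
  have hL := hS.trans hSL
  rwa [← hσ0, hσ.dist_zero_left ⟨le_rfl, hL⟩ ⟨hL, le_rfl⟩ hL]

theorem pt_mem_coneNhd_self (hζ : IsometricOn ζ (Ici 0)) (hT : S ≤ T) :
    .pt (ζ T) ∈ coneNhd ζ S :=
  ⟨ζ, rfl, ⟨T, hT, hζ.mono Icc_subset_Ici_self, rfl⟩, by simp⟩

variable [HadamardSpace X]

theorem coneNhd_mem_nhds {ξ : Boundary X} (hζ : IsometricOn ζ (Ici 0)) (hξ : EndsAt ζ ξ)
    (hS : 0 ≤ S) : coneNhd ζ S ∈ 𝓝 (.bd ξ) := by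
  have hS1 : 0 ≤ S + 1 := by linarith
  lift S + 1 to ℝ≥0 using hS1 with T hT
  have hopen : IsOpen {z | ∃ σ : ℝ≥0 → X, IsGeodesicTo σ (ζ 0) z ∧
      σ T ∈ Metric.ball (ζ T) (1 / 2)} :=
    TopologicalSpace.isOpen_generateFrom_of_mem ⟨_, _, _, Metric.isOpen_ball, rfl⟩
  refine mem_of_superset (hopen.mem_nhds ⟨fun t => ζ t, ⟨GeodesicRay.ofCurve ζ hζ, rfl, rfl,
    GeodesicRay.endpoint_ofCurve_eq_iff.2 hξ⟩, Metric.mem_ball_self one_half_pos⟩) ?_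
  rintro z ⟨σ, hσ, hball⟩
  rw [Metric.mem_ball] at hball
  obtain ⟨hbeyond, hend⟩ := hσ.isGeodesicBeyond T
  set a := dist (ζ 0) (σ T)
  have hζT : dist (ζ 0) (ζ T) = T := hζ.dist_zero_left self_mem_Ici T.2 T.2
  have hSa : S ≤ a := by linarith [dist_triangle (ζ 0) (σ T) (ζ T)]
  have hσ0 : σ (0 : ℝ).toNNReal = ζ 0 := by
    rw [Real.toNNReal_zero]
    cases z with
    | pt y => exact hσ.1
    | bd ξ' => exact hσ.choose_spec.2.1
  refine ⟨fun t => σ t.toNNReal, hσ0, hbeyond.anti hSa, ?_⟩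
  have hclose := dist_le_fellow_travel (hS.trans hSa) (hζ.mono Icc_subset_Ici_self)
    hbeyond.isometricOn (a := T) ⟨hS, by linarith⟩ hSa
  rw [hσ0, dist_self, zero_add, hend, dist_comm, dist_comm (ζ T)] at hclose
  have hST : S / T ≤ 1 := div_le_one_of_le₀ (by linarith) T.2
  nlinarith [dist_nonneg (x := σ T) (y := ζ T)]

theorem IsGeodesicBeyond.dist_le_div (hζ : IsometricOn ζ (Ici 0)) {σ : ℝ → X} (hσ0 : σ 0 = ζ 0)
    (hσ : IsGeodesicBeyond σ S z) (hσS : dist (σ S) (ζ S) ≤ 1) (hT : T ∈ Icc 0 S) :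
    dist (σ T) (ζ T) ≤ T / S :=
  (dist_le_of_common_start hσ.isometricOn (hζ.mono Icc_subset_Ici_self) hσ0 hT).trans
    (mul_le_of_le_one_right (div_nonneg hT.1 (hT.1.trans hT.2)) hσS)

theorem coneNhd_anti (hζ : IsometricOn ζ (Ici 0)) (hT : T ∈ Icc 0 S) :
    coneNhd ζ S ⊆ coneNhd ζ T := by
  rintro z ⟨σ, hσ0, hσ, hσS⟩
  exact ⟨σ, hσ0, hσ.anti hT.2, (hσ.dist_le_div hζ hσ0 hσS hT).trans
    (div_le_one_of_le₀ hT.2 (hT.1.trans hT.2))⟩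

theorem pt_mem_coneNhd_of_dist_le (hζ : IsometricOn ζ (Ici 0)) (hS : 0 ≤ S) {r : ℝ} {y y' : X}
    (hy : .pt y ∈ coneNhd ζ (S * (2 * r + 1) + r)) (hyy' : dist y y' ≤ r) :
    .pt y' ∈ coneNhd ζ S := by
  have hr : 0 ≤ r := dist_nonneg.trans hyy'
  have hSr : 0 ≤ S * (2 * r) := by positivity
  set S' := S * (2 * r + 1) + r with hS'
  have hSS' : S ≤ S' := by linarith
  obtain ⟨σ, hσ0, ⟨L, hL, hσ, rfl⟩, hσS'⟩ := hy
  obtain ⟨c, hc0, hcy', hc⟩ := exists_isometricOn (ζ 0) y'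
  have hL0 : 0 ≤ L := hS.trans (hSS'.trans hL)
  have hζL : dist (ζ 0) (σ L) = L := by
    rw [← hσ0, hσ.dist_zero_left ⟨le_rfl, hL0⟩ ⟨hL0, le_rfl⟩ hL0]
  have hSy' : S ≤ dist (ζ 0) y' := by linarith [dist_triangle_right (ζ 0) (σ L) y']
  refine ⟨c, hc0, ⟨_, hSy', hc, hcy'⟩, ?_⟩
  have hSL : S / L ≤ S / S' := by
    rcases hS.eq_or_lt with rfl | hS
    · simp
    · exact div_le_div_of_nonneg_left hS.le (hS.trans_le hSS') hL
  have hσζ : dist (σ S) (ζ S) ≤ S / S' :=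
    IsGeodesicBeyond.dist_le_div (z := .pt (σ L)) hζ hσ0 ⟨L, hL, hσ, rfl⟩ hσS' ⟨hS, hSS'⟩
  have hσc := dist_le_fellow_travel dist_nonneg hσ hc ⟨hS, hSS'.trans hL⟩ hSy'
  rw [hσ0, hc0, dist_self, zero_add, hcy'] at hσc
  calc dist (c S) (ζ S) ≤ dist (σ S) (c S) + dist (σ S) (ζ S) := dist_triangle_left _ _ _
    _ ≤ 2 * (S / L) * r + S / S' := add_le_add (hσc.trans (by gcongr)) hσζ
    _ ≤ 2 * (S / S') * r + S / S' := by gcongr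
    _ = S * (2 * r + 1) / S' := by ring
    _ ≤ 1 := div_le_one_of_le₀ (by linarith) (hS.trans hSS')

theorem exists_pt_mem_coneNhd_eq (hζ : IsometricOn ζ (Ici 0)) {F : X → ℝ} (hF : LipschitzWith 1 F)
    {ε : ℝ} {y : X} (hy : .pt y ∈ coneNhd ζ S) (hT : T ∈ Icc 0 S) (hζT : F (ζ T) + T / S ≤ ε)
    (hFy : ε ≤ F y) : ∃ q, .pt q ∈ coneNhd ζ T ∧ F q = ε := by
  obtain ⟨σ, hσ0, hbeyond, hσS⟩ := hy
  have hσT := hbeyond.dist_le_div hζ hσ0 hσS hT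
  obtain ⟨L, hSL, hσ, rfl⟩ := hbeyond
  have hcont : ContinuousOn (F ∘ σ) (Icc T L) :=
    hF.continuous.comp_continuousOn (hσ.continuousOn.mono (Icc_subset_Icc_left hT.1))
  have hFT : F (σ T) ≤ ε := by
    have hLip := hF.le_add_mul (σ T) (ζ T)
    rw [NNReal.coe_one, one_mul] at hLip
    linarith
  obtain ⟨s, hs, rfl⟩ := intermediate_value_Icc (hT.2.trans hSL) hcont ⟨hFT, hFy⟩
  exact ⟨σ s, ⟨σ, hσ0, ⟨s, hs.1, hσ.mono (Icc_subset_Icc_right hs.2), rfl⟩,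
    hσT.trans (div_le_one_of_le₀ hT.2 (hT.1.trans hT.2))⟩, rfl⟩

end ConeNeighbourhoods

section Limits

variable {X : Type*} [MetricSpace X]

/-- `f` is a geodesic, parametrized on a closed unbounded interval containing `[0,∞)`, which starts
at distance at most `R` from `z` if `z` is a point of `X`, and comes from `z` if `z` is a boundary
point. -/
def IssuesFrom (f : ℝ → X) (R : ℝ) : Compactification X → Prop
  | .pt y => ∃ b, 0 ≤ b ∧ IsometricOn f (Ici (-b)) ∧ dist (f (-b)) y ≤ R
  | .bd ξ => IsometricOn f univ ∧ EndsAt (fun t => f (-t)) ξ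

variable {f : ℝ → X} {R T : ℝ} {z : Compactification X}

theorem IssuesFrom.isometricOn (h : IssuesFrom f R z) : IsometricOn f (Ici 0) := by
  cases z with
  | pt y =>
    obtain ⟨b, hb, hf, -⟩ := h
    exact hf.mono (Ici_subset_Ici.2 (neg_nonpos.2 hb))
  | bd ξ => exact h.1.mono (subset_univ _)

theorem IsometricOn.issuesFrom_pt (hf : IsometricOn f (Ici 0)) {t : ℝ} (ht : 0 ≤ t) {y : X}
    (hy : dist (f 0) y ≤ R) : IssuesFrom (fun s => f (t + s)) R (.pt y) :=
  ⟨t, ht, hf.comp_const_add t fun s hs => neg_le_iff_add_nonneg'.1 (mem_Ici.1 hs),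
    by simpa only [add_neg_cancel] using hy⟩

variable [HadamardSpace X]

theorem IssuesFrom.isometricOn_and_dist_le (hf : IssuesFrom f R z) {σ : ℝ → X}
    (hσ : IsGeodesicBeyond σ (T + 2 * R) z) (h0 : dist (f 0) (σ 0) ≤ R) (hT : 0 ≤ T) :
    IsometricOn f (Ici (-T)) ∧ dist (f (-T)) (σ T) ≤ 3 * R := by
  have hR : 0 ≤ R := dist_nonneg.trans h0
  cases z with
  | pt y =>
    obtain ⟨b, hb, hf, hfy⟩ := hf
    obtain ⟨L, hL, hσ, rfl⟩ := hσ
    have hL0 : 0 ≤ L := by linarith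
    have hreverse : IsometricOn (fun t => f (0 - t)) (Icc 0 b) :=
      hf.comp_const_sub 0 fun t ht => by simpa using ht.2
    have hTb : T ≤ b := by
      have hfb := hreverse.dist_zero_left ⟨le_rfl, hb⟩ ⟨hb, le_rfl⟩ hb
      have hσL := hσ.dist_zero_left ⟨le_rfl, hL0⟩ ⟨hL0, le_rfl⟩ hL0
      rw [sub_zero, zero_sub] at hfb
      linarith [dist_triangle4_left (f 0) (f (-b)) (σ 0) (σ L), dist_comm (f 0) (σ 0)]
    refine ⟨hf.mono (Ici_subset_Ici.2 (neg_le_neg hTb)), ?_⟩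
    have hclose := dist_le_fellow_travel hL0 hreverse hσ ⟨hT, hTb⟩ (by linarith)
    simp only [zero_sub, neg_zero] at hclose
    have hTb1 : T / b ≤ 1 := div_le_one_of_le₀ hTb hb
    calc dist (f (-T)) (σ T) ≤ dist (f 0) (σ 0) + 2 * (T / b) * dist (f (-b)) (σ L) := hclose
      _ ≤ R + 2 * 1 * R := by gcongr
      _ = 3 * R := by ring
  | bd ξ =>
    obtain ⟨hf, hfξ⟩ := hf
    have hreverse : IsometricOn (fun t => f (-t)) (Ici 0) := by
      simpa only [zero_sub] using hf.comp_const_sub 0 fun _ _ => mem_univ _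
    have hclose := hfξ.dist_le hσ.2 hreverse hσ.1 hT
    rw [neg_zero] at hclose
    exact ⟨hf.mono (subset_univ _), by linarith⟩

variable [ProperSpace X]

theorem exists_line_of_issuesFrom {ι : Type*} (U : Ultrafilter ι) {ξ η : Boundary X} {ζ : ℝ → X}
    (hζ : IsometricOn ζ (Ici 0)) (hζξ : EndsAt ζ ξ) {z : ι → Compactification X}
    (hz : ∀ S, 0 ≤ S → ∀ᶠ n in U, z n ∈ coneNhd ζ S) {f : ι → ℝ → X}
    (hf : ∀ᶠ n in U, IssuesFrom (f n) R (z n) ∧ dist (f n 0) (ζ 0) ≤ R ∧ EndsAt (f n) η) :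
    ∃ w : GeodesicLine X, w.neg = ξ ∧ w.pos = η ∧ ∀ t, Tendsto (fun n => f n t) U (𝓝 (w t)) := by
  have hR : 0 ≤ R := by
    obtain ⟨n, -, hn, -⟩ := hf.exists
    exact dist_nonneg.trans hn
  have hback (T : ℝ) (hT : 0 ≤ T) :
      ∀ᶠ n in U, IsometricOn (f n) (Ici (-T)) ∧ dist (f n (-T)) (ζ T) ≤ 3 * R + 1 := by
    filter_upwards [hf, hz (T + 2 * R) (by linarith)] with n ⟨hissues, h0, _⟩ ⟨σ, hσ0, hσ, hσζ⟩
    obtain ⟨hiso, hfσ⟩ := hissues.isometricOn_and_dist_le hσ (by rwa [hσ0]) hT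
    have hTS : T ≤ T + 2 * R := by linarith
    have hσT := (hσ.dist_le_div hζ hσ0 hσζ ⟨hT, hTS⟩).trans
      (div_le_one_of_le₀ hTS (hT.trans hTS))
    exact ⟨hiso, (dist_triangle _ _ _).trans (add_le_add hfσ hσT)⟩
  refine exists_line_limit U (C := 3 * R + 1) hζξ (endsAt_ray (ζ 0) η) (fun T => ?_)
    (fun t ht => (hback t ht).mono fun _ h => h.2) fun t ht => ?_
  · filter_upwards [hback _ (abs_nonneg T)] with n hn
    exact hn.1.mono (Ici_subset_Ici.2 (neg_le_neg (le_abs_self T)))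
  · filter_upwards [hf] with n ⟨hissues, h0, hη⟩
    have hforward := hη.dist_le (endsAt_ray (ζ 0) η) hissues.isometricOn (isometricOn_ray _ _) ht
    rw [ray_zero] at hforward
    linarith

end Limits

section RayDistance

variable {X : Type*} [MetricSpace X] [ProperSpace X] [HadamardSpace X]

/-- The distance of the point `o` from the ray `σ_{p,η}`. -/
noncomputable def rayDist (η : Boundary X) (o p : X) : ℝ :=
  Metric.infDist o (ray p η '' Ici 0)

variable {η : Boundary X} {o p : X} {R : ℝ}

theorem rayDist_lt_iff : rayDist η o p < R ↔ ∃ t, 0 ≤ t ∧ dist (ray p η t) o < R := by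
  rw [rayDist, Metric.infDist_lt_iff (nonempty_Ici.image _), exists_mem_image]
  simp only [dist_comm o, mem_Ici]

theorem rayDist_le_dist_ray {t : ℝ} (ht : 0 ≤ t) : rayDist η o p ≤ dist (ray p η t) o := by
  rw [dist_comm]
  exact Metric.infDist_le_dist_of_mem (mem_image_of_mem _ ht)

theorem rayDist_le_dist {c : ℝ → X} (hc : IsometricOn c (Ici 0)) (hη : EndsAt c η) {t : ℝ}
    (ht : 0 ≤ t) : rayDist η o (c 0) ≤ dist (c t) o := by
  have hunique := (endsAt_ray (c 0) η).dist_le hη (isometricOn_ray _ _) hc ht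
  rw [ray_zero, dist_self, dist_le_zero] at hunique
  rw [← hunique]
  exact rayDist_le_dist_ray ht

theorem rayMeetsBall_iff_rayDist_lt : RayMeetsBall R p η o ↔ rayDist η o p < R := by
  constructor
  · rintro ⟨σ, rfl, hη, t, ht⟩
    have h := rayDist_le_dist (o := o) σ.isometricOn_extend
      (GeodesicRay.endsAt_extend_iff.2 hη) t.coe_nonneg
    rw [GeodesicRay.extend, GeodesicRay.extend, Real.toNNReal_coe, Real.toNNReal_zero] at h
    exact h.trans_lt ht
  · intro h
    obtain ⟨t, ht, hto⟩ := rayDist_lt_iff.1 h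
    exact ⟨GeodesicRay.ofCurve _ (isometricOn_ray p η), ray_zero p η,
      GeodesicRay.endpoint_ofCurve_eq_iff.2 (endsAt_ray p η), ⟨t, ht⟩, hto⟩

theorem lipschitzWith_rayDist (η : Boundary X) (o : X) : LipschitzWith 1 (rayDist η o) := by
  refine LipschitzWith.of_le_add fun p q => le_of_forall_pos_lt_add fun δ hδ => ?_
  obtain ⟨t, ht, hto⟩ := rayDist_lt_iff.1 (lt_add_of_pos_right (rayDist η o q) hδ)
  have hpq := (endsAt_ray p η).dist_le (endsAt_ray q η) (isometricOn_ray _ _)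
    (isometricOn_ray _ _) ht
  rw [ray_zero, ray_zero] at hpq
  linarith [rayDist_le_dist_ray (η := η) (o := o) (p := p) ht,
    dist_triangle (ray p η t) (ray q η t) o]

theorem exists_line_of_rayDist_mem_Ico {ξ : Boundary X} {ζ : ℝ → X} (hζ : IsometricOn ζ (Ici 0))
    (hζξ : EndsAt ζ ξ) {q : ℕ → X} (hq : ∀ n : ℕ, .pt (q n) ∈ coneNhd ζ n) {ε : ℝ}
    (hqη : ∀ n, rayDist η (ζ 0) (q n) ∈ Ico ε R) :
    ∃ w : GeodesicLine X, w.neg = ξ ∧ w.pos = η ∧ dist (w 0) (ζ 0) ≤ R ∧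
      ∀ s, ε ≤ dist (w s) (ζ 0) := by
  choose b hb hbζ using fun n => rayDist_lt_iff.1 (hqη n).2
  have hb0 (n : ℕ) : dist (ray (q n) η (b n + 0)) (ζ 0) ≤ R := by
    rw [add_zero]
    exact (hbζ n).le
  have hfar (s : ℝ) : ∀ᶠ n : ℕ in hyperfilter ℕ, s ≤ n :=
    (tendsto_natCast_atTop_atTop.eventually_ge_atTop s).filter_mono Nat.hyperfilter_le_atTop
  have hz (S : ℝ) (hS : 0 ≤ S) : ∀ᶠ n in hyperfilter ℕ, .pt (q n) ∈ coneNhd ζ S :=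
    (hfar S).mono fun n hn => coneNhd_anti hζ ⟨hS, hn⟩ (hq n)
  have hR : 0 ≤ R := dist_nonneg.trans (hbζ 0).le
  obtain ⟨w, hwn, hwp, hlim⟩ := exists_line_of_issuesFrom (hyperfilter ℕ) (η := η) hζ hζξ hz
    (f := fun n s => ray (q n) η (b n + s)) (Eventually.of_forall fun n =>
      ⟨(isometricOn_ray _ _).issuesFrom_pt (hb n) (by rwa [ray_zero, dist_self]), hb0 n,
        (endsAt_ray _ _).comp_const_add (isometricOn_ray _ _) (hb n)⟩)
  refine ⟨w, hwn, hwp, le_of_tendsto' ((hlim 0).dist tendsto_const_nhds) hb0, fun s =>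
    ge_of_tendsto ((hlim s).dist tendsto_const_nhds) ?_⟩
  filter_upwards [hfar (R - s)] with n hn
  have hqb : dist (q n) (ray (q n) η (b n)) = b n := by
    simpa only [ray_zero] using (isometricOn_ray (q n) η).dist_zero_left self_mem_Ici (hb n) (hb n)
  have hζq := le_dist_of_pt_mem_coneNhd n.cast_nonneg (hq n)
  have hbs : 0 ≤ b n + s := by
    linarith [dist_triangle_right (ζ 0) (q n) (ray (q n) η (b n)), hbζ n,
      dist_comm (ζ 0) (ray (q n) η (b n))]
  exact (hqη n).1.trans (rayDist_le_dist_ray hbs)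

theorem exists_forall_rayDist_lt {u : GeodesicLine X} (hu : AtMostOneLine u.neg u.pos) {ε : ℝ}
    (hε : 0 < ε) :
    ∃ S, 0 ≤ S ∧ ∀ p, .pt p ∈ coneNhd u.reverse S → rayDist u.pos (u 0) p < ε := by
  have hrev0 : u.reverse 0 = u 0 := by rw [GeodesicLine.reverse_apply, neg_zero]
  have hrev : IsometricOn u.reverse (Ici 0) := u.reverse.isometricOn _
  have hon_line (n : ℕ) : rayDist u.pos (u 0) (u.reverse n) ≤ 0 := by
    have h := rayDist_le_dist (o := u 0) ((GeodesicLine.flow (-n) u).isometricOn _)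
      (GeodesicLine.endsAt_iff_pos_eq.2 (GeodesicLine.pos_flow (-n) u)) n.cast_nonneg
    rwa [GeodesicLine.flow_apply, GeodesicLine.flow_apply, zero_add, add_neg_cancel, dist_self]
      at h
  by_contra! hfar
  -- The ray from `u.reverse n` passes through `u 0`, so by the intermediate value theorem some
  -- point near `u.neg` has a ray at distance exactly `ε` from `u 0`.
  have hexists (n : ℕ) : ∃ q, .pt q ∈ coneNhd u.reverse n ∧ rayDist u.pos (u 0) q = ε := by
    have hn : (0 : ℝ) ≤ n := n.cast_nonneg
    obtain ⟨y, hy, hεy⟩ := hfar (max n (n / ε)) (le_max_of_le_left hn)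
    refine exists_pt_mem_coneNhd_eq hrev (lipschitzWith_rayDist _ _) hy ⟨hn, le_max_left _ _⟩ ?_ hεy
    have hquot : n / max (n : ℝ) (n / ε) ≤ ε := div_le_of_le_mul₀ (le_max_of_le_left hn) hε.le
      ((div_le_iff₀' hε).1 (le_max_right _ _))
    linarith [hon_line n]
  choose q hq hqε using hexists
  obtain ⟨w, hwn, hwp, -, hw⟩ := exists_line_of_rayDist_mem_Ico (R := 2 * ε) hrev u.endsAt_neg hq
    fun n => by rw [hrev0, hqε]; exact ⟨le_rfl, lt_two_mul_self hε⟩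
  obtain ⟨s, hs⟩ := hu w hwn hwp ⟨u, rfl, rfl, rfl⟩
  have hεs := hw s
  rw [hs, hrev0, dist_self] at hεs
  exact hεs.not_gt hε

end RayDistance

section Shadows

variable {X : Type*} [MetricSpace X]

theorem smallShadow_subset_largeShadow {r : ℝ} (hr : 0 < r) (z : Compactification X) (x : X) :
    smallShadow r z x ⊆ largeShadow r z x := by
  cases z with
  | pt y => exact fun η hη => ⟨y, Metric.mem_ball_self hr, hη y (Metric.mem_ball_self hr)⟩
  | bd ξ => exact Subset.rfl

theorem mem_shadow_or_mem_shadowFrontier {r : ℝ} {x : X} (w : GeodesicLine X)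
    (hw : dist (w 0) x ≤ r) :
    w.pos ∈ shadow r w.neg x ∪ shadowFrontier r w.neg x := by
  have hmem : w 0 ∈ joinSet w.neg w.pos := ⟨w, rfl, rfl, rfl⟩
  have hle : Metric.infDist x (joinSet w.neg w.pos) ≤ r :=
    (Metric.infDist_le_dist_of_mem hmem).trans (by rwa [dist_comm])
  rcases hle.eq_or_lt with heq | hlt
  · exact Or.inr ⟨⟨w, rfl, rfl⟩, heq⟩
  · obtain ⟨_, ⟨v, hvn, hvp, rfl⟩, hv⟩ := (Metric.infDist_lt_iff ⟨_, hmem⟩).1 hlt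
    exact Or.inl ⟨v, hvn, hvp, by rwa [Metric.mem_ball, dist_comm]⟩

variable [ProperSpace X] [HadamardSpace X] {r : ℝ} {x : X} {ξ η : Boundary X}

theorem exists_issuesFrom_of_mem_largeShadow {z : Compactification X}
    (hη : η ∈ largeShadow r z x) :
    ∃ f : ℝ → X, dist (f 0) x < r ∧ IssuesFrom f r z ∧ EndsAt f η := by
  cases z with
  | pt y =>
    obtain ⟨y', hy', hmeets⟩ := hη
    obtain ⟨t, ht, htx⟩ := rayDist_lt_iff.1 (rayMeetsBall_iff_rayDist_lt.1 hmeets)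
    refine ⟨fun s => ray y' η (t + s), by simpa only [add_zero] using htx,
      (isometricOn_ray y' η).issuesFrom_pt ht ?_,
      (endsAt_ray y' η).comp_const_add (isometricOn_ray y' η) ht⟩
    rw [ray_zero]
    exact hy'.le
  | bd ξ =>
    obtain ⟨v, hvn, rfl, hvx⟩ := hη
    exact ⟨v, hvx, ⟨v.isometricOn _, GeodesicLine.endsAt_reverse_iff_neg_eq.2 hvn⟩, v.endsAt_pos⟩

theorem mem_shadow_or_mem_shadowFrontier_of_frequently
    (hη : ∃ᶠ z in 𝓝 (.bd ξ), η ∈ largeShadow r z x) :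
    η ∈ shadow r ξ x ∪ shadowFrontier r ξ x := by
  have := frequently_iff_neBot.1 hη
  set U := Ultrafilter.of (𝓝 (.bd ξ) ⊓ 𝓟 {z | η ∈ largeShadow r z x})
  have hU : ↑U ≤ 𝓝 (.bd ξ) ⊓ 𝓟 {z | η ∈ largeShadow r z x} := Ultrafilter.of_le _
  have : Nonempty X := ⟨x⟩
  choose! f hfx hf hfη using fun z => exists_issuesFrom_of_mem_largeShadow (z := z) (η := η)
    (r := r) (x := x)
  have hmem : ∀ᶠ z in U, η ∈ largeShadow r z x := le_principal_iff.1 (hU.trans inf_le_right)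
  have hbound : ∀ᶠ z in U, dist (f z 0) x ≤ r := hmem.mono fun z hz => (hfx z hz).le
  obtain ⟨w, rfl, rfl, hlim⟩ := exists_line_of_issuesFrom U (isometricOn_ray x ξ) (endsAt_ray x ξ)
    (z := id) (fun S hS => hU.trans inf_le_left
      (coneNhd_mem_nhds (isometricOn_ray x ξ) (endsAt_ray x ξ) hS))
    (hmem.mono fun z hz => ⟨hf z hz, by rw [ray_zero]; exact (hfx z hz).le, hfη z hz⟩)
  exact mem_shadow_or_mem_shadowFrontier w (le_of_tendsto ((hlim 0).dist tendsto_const_nhds) hbound)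

theorem exists_line_of_forall_rayDist_lt {u : GeodesicLine X} {S ε : ℝ} (hS : 0 ≤ S)
    (hu : ∀ p, .pt p ∈ coneNhd u.reverse S → rayDist u.pos (u 0) p < ε)
    (hξ : .bd ξ ∈ coneNhd u.reverse S) :
    ∃ w : GeodesicLine X, w.neg = ξ ∧ w.pos = u.pos ∧ dist (w 0) (u 0) ≤ ε := by
  obtain ⟨σ, hσ0, ⟨hσ, hσξ⟩, hσS⟩ := hξ
  rw [GeodesicLine.reverse_apply, neg_zero] at hσ0
  have hnear (n : ℕ) : rayDist u.pos (σ 0) (σ (S + n)) ∈ Ico 0 ε := by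
    rw [hσ0]
    refine ⟨Metric.infDist_nonneg, hu _ ⟨σ, ?_, ⟨S + n, ?_, hσ.mono Icc_subset_Ici_self, rfl⟩, hσS⟩⟩
    · rw [hσ0, GeodesicLine.reverse_apply, neg_zero]
    · exact le_add_of_nonneg_right n.cast_nonneg
  obtain ⟨w, hwn, hwp, hw, -⟩ := exists_line_of_rayDist_mem_Ico hσ hσξ
    (fun n => pt_mem_coneNhd_self hσ (le_add_of_nonneg_left hS)) hnear
  exact ⟨w, hwn, hwp, by rwa [← hσ0]⟩

theorem eventually_mem_smallShadow (hη : η ∈ shadow r ξ x) (hunique : AtMostOneLine ξ η) :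
    ∀ᶠ z in 𝓝 (.bd ξ), η ∈ smallShadow r z x := by
  obtain ⟨u, rfl, rfl, hux⟩ := hη
  rw [Metric.mem_ball] at hux
  have hr : 0 ≤ r := dist_nonneg.trans hux.le
  obtain ⟨ε, hε, hεr⟩ := exists_between (sub_pos.2 hux)
  obtain ⟨S, hS, hnear⟩ := exists_forall_rayDist_lt hunique hε
  have hSS' : S ≤ S * (2 * r + 1) + r := by nlinarith
  have hrev : IsometricOn u.reverse (Ici 0) := u.reverse.isometricOn _
  filter_upwards [coneNhd_mem_nhds hrev u.endsAt_neg (hS.trans hSS')] with z hz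
  cases z with
  | pt y =>
    intro y' hy'
    have hlt := hnear y' (pt_mem_coneNhd_of_dist_le hrev hS hz (Metric.mem_ball'.1 hy').le)
    have hle : rayDist u.pos x y' ≤ rayDist u.pos (u 0) y' + dist x (u 0) :=
      Metric.infDist_le_infDist_add_dist
    rw [dist_comm] at hle
    exact rayMeetsBall_iff_rayDist_lt.2 (by linarith)
  | bd ξ' =>
    obtain ⟨w, hwn, hwp, hw⟩ :=
      exists_line_of_forall_rayDist_lt hS hnear (coneNhd_anti hrev ⟨hS, hSS'⟩ hz)
    refine ⟨w, hwn, hwp, ?_⟩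
    rw [Metric.mem_ball]
    linarith [dist_triangle (w 0) (u 0) x]

end Shadows

end CAT0

theorem mainTheorem6_general {X : Type*} [MetricSpace X] [ProperSpace X] [HadamardSpace X]
    (ξ : Boundary X) (x : X) (r : ℝ) (hr : 0 < r) {A : Set (Boundary X)}
    (hA : ∀ η ∈ A, AtMostOneLine ξ η) {ι : Type*} {l : Filter ι} (z : ι → Compactification X)
    (hz : Tendsto z l (𝓝 (Compactification.bd ξ))) :
    (limsup (fun n => largeShadow r (z n) x ∩ A) l ⊆
        (shadow r ξ x ∪ shadowFrontier r ξ x) ∩ A ∧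
      limsup (fun n => smallShadow r (z n) x ∩ A) l ⊆
        (shadow r ξ x ∪ shadowFrontier r ξ x) ∩ A) ∧
    (shadow r ξ x ∩ A ⊆ liminf (fun n => largeShadow r (z n) x ∩ A) l ∧
      shadow r ξ x ∩ A ⊆ liminf (fun n => smallShadow r (z n) x ∩ A) l) := by
  have hsub (n : ι) : smallShadow r (z n) x ∩ A ⊆ largeShadow r (z n) x ∩ A :=
    inter_subset_inter_left _ (smallShadow_subset_largeShadow hr (z n) x)
  have hlimsup : limsup (fun n => largeShadow r (z n) x ∩ A) l ⊆
      (shadow r ξ x ∪ shadowFrontier r ξ x) ∩ A := by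
    intro η hη
    rw [mem_limsup_iff_frequently_mem] at hη
    exact ⟨mem_shadow_or_mem_shadowFrontier_of_frequently
      (hz.frequently (hη.mono fun _ h => h.1)), hη.exists.choose_spec.2⟩
  have hliminf : shadow r ξ x ∩ A ⊆ liminf (fun n => smallShadow r (z n) x ∩ A) l := by
    rintro η ⟨hη, hηA⟩
    rw [mem_liminf_iff_eventually_mem]
    exact (hz.eventually (eventually_mem_smallShadow hη (hA η hηA))).mono fun _ h => ⟨h, hηA⟩
  exact ⟨⟨hlimsup, (limsup_le_limsup (Eventually.of_forall hsub)).trans hlimsup⟩,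
    ⟨hliminf.trans (liminf_le_liminf (Eventually.of_forall hsub)), hliminf⟩⟩

theorem mainTheorem6 {X : Type*} [MetricSpace X] [ProperSpace X] [HadamardSpace X]
    (ξ : Boundary X) (x : X) (r : ℝ) (hr : 0 < r)
    (z : ℕ → Compactification X) (hz : Tendsto z atTop (𝓝 (Compactification.bd ξ))) :
    (limsup (fun n => largeShadow r (z n) x ∩ recBoundary X) atTop ⊆
        (shadow r ξ x ∪ shadowFrontier r ξ x) ∩ recBoundary X ∧
      limsup (fun n => smallShadow r (z n) x ∩ recBoundary X) atTop ⊆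
        (shadow r ξ x ∪ shadowFrontier r ξ x) ∩ recBoundary X) ∧
    (shadow r ξ x ∩ recBoundary X ⊆
        liminf (fun n => largeShadow r (z n) x ∩ recBoundary X) atTop ∧
      shadow r ξ x ∩ recBoundary X ⊆
        liminf (fun n => smallShadow r (z n) x ∩ recBoundary X) atTop) :=
  mainTheorem6_general ξ x r hr (fun _ hη => atMostOneLine_of_mem_recBoundary hη ξ) z hz
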